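/- Let $\mathcal{H}$ be a complex Hilbert space (of finite or infinite dimension) and let $\mathfrak{B}$ be the space of trace-class operators on $\mathcal{H}$ (all linear operators if $\dim\mathcal{H}<\infty$). A universal dynamical map (UDM) is a completely positive, trace-preserving, complex-linear map $\mathcal{E}:\mathfrak{B}\to\mathfrak{B}$; completely positive means that, for every $n\ge 1$, the map $\mathcal{E}\otimes\mathrm{id}_n$, which applies $\mathcal{E}$ to each entry of an $n\times n$ block operator with entries in $\mathfrak{B}$, sends positive semidefinite block operators on $\mathcal{H}\otimes\mathbb{C}^n$ to positive semidefinite ones. Let $\mathcal{E}$ be a UDM. Then there is a UDM $\mathcal{F}$ with $\mathcal{F}\circ\mathcal{E}=\mathcal{E}\circ\mathcal{F}=\mathrm{id}_{\mathfrak{B}}$ if and only if there is a unitary operator $U$ on $\mathcal{H}$ such that $\mathcal{E}(\rho)=U\rho U^\dagger$ for all $\rho\in\mathfrak{B}$. -/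

import Mathlib

namespace QuantumDynamics

open scoped InnerProductSpace ComplexOrder

variable (H : Type*) [NormedAddCommGroup H] [InnerProductSpace ℂ H] [CompleteSpace H]

/-- The index set of a fixed orthonormal (Hilbert) basis of `H`. -/
def basisIndex : Set H := (exists_hilbertBasis ℂ H).choose

/-- A fixed orthonormal (Hilbert) basis of `H`. -/
noncomputable def basis : HilbertBasis (basisIndex H) ℂ H :=
  (exists_hilbertBasis ℂ H).choose_spec.choose

variable {H}

/-- `T` is a positive semidefinite bounded operator with `∑ i, ⟪e i, T (e i)⟫ < ∞`.
By `HasFiniteTrace.hasSum` below, this does not depend on the orthonormal basis. -/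
def HasFiniteTrace (T : H →L[ℂ] H) : Prop :=
  T.IsPositive ∧ Summable fun i => (⟪basis H i, T (basis H i)⟫_ℂ).re

variable (H) in
/-- The trace-class operators on `H`: the complex linear span, among the bounded operators, of
the positive operators with finite trace. -/
def traceClass : Submodule ℂ (H →L[ℂ] H) := Submodule.span ℂ {T | HasFiniteTrace T}

/-- The trace `∑ i, ⟪e i, T (e i)⟫` of an operator. For trace-class `T` the series converges
absolutely, and its sum does not depend on the orthonormal basis, see `hasSum_trace`. -/
noncomputable def trace (T : H →L[ℂ] H) : ℂ := ∑' i, ⟪basis H i, T (basis H i)⟫_ℂ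

/-- Complete positivity of a linear map `E` on the trace-class operators: for every `n`, the map
`E ⊗ id` (that is, `E` applied entrywise) sends positive semidefinite `n × n` block operators with
trace-class entries to positive semidefinite ones. A block operator `(T i j)` acts on the direct sum
of `n` copies of `H`, and it is positive semidefinite when `∑ i j, ⟪x i, T i j (x j)⟫ ≥ 0` for all
`x`; the order on `ℂ` is the one for which `0 ≤ z` means that `z` is real and nonnegative. -/
def IsCompletelyPositive (E : traceClass H →ₗ[ℂ] traceClass H) : Prop :=
  ∀ (n : ℕ) (T : Fin n → Fin n → traceClass H),
    (∀ x : Fin n → H, 0 ≤ ∑ i, ∑ j, ⟪x i, (T i j : H →L[ℂ] H) (x j)⟫_ℂ) →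
    ∀ x : Fin n → H, 0 ≤ ∑ i, ∑ j, ⟪x i, (E (T i j) : H →L[ℂ] H) (x j)⟫_ℂ

/-- `E` preserves the trace of every trace-class operator. -/
def IsTracePreserving (E : traceClass H →ₗ[ℂ] traceClass H) : Prop :=
  ∀ T : traceClass H, trace (E T : H →L[ℂ] H) = trace (T : H →L[ℂ] H)

/-- A universal dynamical map: a completely positive, trace-preserving linear map on the
trace-class operators. -/
structure IsUniversalDynamicalMap (E : traceClass H →ₗ[ℂ] traceClass H) : Prop where
  completelyPositive : IsCompletelyPositive E
  tracePreserving : IsTracePreserving E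

/-- `E` is the unitary conjugation `ρ ↦ U ρ U†` for some unitary operator `U` on `H`. -/
def IsUnitaryConjugation (E : traceClass H →ₗ[ℂ] traceClass H) : Prop :=
  ∃ U ∈ unitary (H →L[ℂ] H), ∀ ρ : traceClass H,
    (E ρ : H →L[ℂ] H) = U ∘L (ρ : H →L[ℂ] H) ∘L ContinuousLinearMap.adjoint U

/-! Well-definedness of the trace: convergence, and independence of the orthonormal basis. -/

theorem parseval {ι : Type*} (b : HilbertBasis ι ℂ H) (x : H) :
    ∑' i, ENNReal.ofReal (‖⟪b i, x⟫_ℂ‖ ^ 2) = ENNReal.ofReal (‖x‖ ^ 2) := by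
  have h := b.hasSum_inner_mul_inner x x
  have h2 : HasSum (fun i => ‖⟪b i, x⟫_ℂ‖ ^ 2) (‖x‖ ^ 2) := by
    rw [← Complex.hasSum_ofReal]
    have h1 : ((‖x‖ ^ 2 : ℝ) : ℂ) = ⟪x, x⟫_ℂ := by
      rw [inner_self_eq_norm_sq_to_K]
      push_cast
      rfl
    have h3 : (fun i => ((‖⟪b i, x⟫_ℂ‖ ^ 2 : ℝ) : ℂ)) = fun i => ⟪x, b i⟫_ℂ * ⟪b i, x⟫_ℂ := by
      funext i
      rw [← inner_conj_symm x (b i), Complex.conj_mul']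
      push_cast
      rfl
    rw [h1, h3]
    exact h
  rw [← h2.tsum_eq, ENNReal.ofReal_tsum_of_nonneg (fun i => by positivity) h2.summable]

theorem tsum_inner_eq {ι κ : Type*} (b : HilbertBasis ι ℂ H) (c : HilbertBasis κ ℂ H)
    {T : H →L[ℂ] H} (hT : T.IsPositive) :
    ∑' i, ENNReal.ofReal (⟪b i, T (b i)⟫_ℂ).re =
      ∑' j, ENNReal.ofReal (⟪c j, T (c j)⟫_ℂ).re := by
  obtain ⟨S, hS, hST⟩ : ∃ S : H →L[ℂ] H, (∀ x y, ⟪S x, y⟫_ℂ = ⟪x, S y⟫_ℂ) ∧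
      ∀ x, (⟪x, T x⟫_ℂ).re = ‖S x‖ ^ 2 := by
    have hT0 : 0 ≤ T := (ContinuousLinearMap.nonneg_iff_isPositive T).2 hT
    have hpos : (CFC.sqrt T).IsPositive :=
      (ContinuousLinearMap.nonneg_iff_isPositive _).1 (CFC.sqrt_nonneg T)
    have hsymm : ∀ x y, ⟪CFC.sqrt T x, y⟫_ℂ = ⟪x, CFC.sqrt T y⟫_ℂ := hpos.isSymmetric
    refine ⟨CFC.sqrt T, hsymm, fun x => ?_⟩
    have h1 : T x = CFC.sqrt T (CFC.sqrt T x) := by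
      conv_lhs => rw [← CFC.sqrt_mul_sqrt_self T hT0]
      rfl
    rw [h1, ← hsymm, inner_self_eq_norm_sq_to_K]
    norm_cast
  simp only [hST]
  calc ∑' i, ENNReal.ofReal (‖S (b i)‖ ^ 2)
      = ∑' i, ∑' j, ENNReal.ofReal (‖⟪c j, S (b i)⟫_ℂ‖ ^ 2) := by simp only [parseval c]
    _ = ∑' j, ∑' i, ENNReal.ofReal (‖⟪c j, S (b i)⟫_ℂ‖ ^ 2) := ENNReal.tsum_comm
    _ = ∑' j, ∑' i, ENNReal.ofReal (‖⟪b i, S (c j)⟫_ℂ‖ ^ 2) := by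
        refine tsum_congr fun j => tsum_congr fun i => ?_
        rw [← hS, norm_inner_symm]
    _ = ∑' j, ENNReal.ofReal (‖S (c j)‖ ^ 2) := by simp only [parseval b]

theorem HasFiniteTrace.hasSum {T : H →L[ℂ] H} (hT : HasFiniteTrace T) {ι : Type*}
    (b : HilbertBasis ι ℂ H) : HasSum (fun i => ⟪b i, T (b i)⟫_ℂ) (trace T) := by
  obtain ⟨hp, hs⟩ := hT
  have hre : ∀ x, ((⟪x, T x⟫_ℂ).re : ℂ) = ⟪x, T x⟫_ℂ := fun x =>
    Complex.ext (by simp) (by simpa using (Complex.nonneg_iff.1 (hp.inner_nonneg_right x)).2)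
  have h0 : ∀ x, 0 ≤ (⟪x, T x⟫_ℂ).re := fun x =>
    (Complex.nonneg_iff.1 (hp.inner_nonneg_right x)).1
  have heq := tsum_inner_eq b (basis H) hp
  rw [← ENNReal.ofReal_tsum_of_nonneg (fun i => h0 _) hs] at heq
  have hsb : Summable fun i => (⟪b i, T (b i)⟫_ℂ).re := by
    have h := ENNReal.summable_toReal (heq ▸ ENNReal.ofReal_ne_top)
    simpa only [ENNReal.toReal_ofReal (h0 _)] using h
  rw [← ENNReal.ofReal_tsum_of_nonneg (fun i => h0 _) hsb,
    ENNReal.ofReal_eq_ofReal_iff (tsum_nonneg fun i => h0 _) (tsum_nonneg fun i => h0 _)] at heq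
  have hb := hsb.hasSum
  rw [heq, ← Complex.hasSum_ofReal, Complex.ofReal_tsum] at hb
  simpa only [trace, hre] using hb

theorem hasSum_trace {T : H →L[ℂ] H} (hT : T ∈ traceClass H) {ι : Type*}
    (b : HilbertBasis ι ℂ H) : HasSum (fun i => ⟪b i, T (b i)⟫_ℂ) (trace T) := by
  suffices h : ∃ z, ∀ (s : Set H) (c : HilbertBasis s ℂ H),
      HasSum (fun i => ⟪c i, T (c i)⟫_ℂ) z ∧ HasSum (fun i => ⟪b i, T (b i)⟫_ℂ) z by
    obtain ⟨z, hz⟩ := h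
    have h := hz _ (basis H)
    have ht : trace T = z := h.1.tsum_eq
    exact ht ▸ h.2
  induction hT using Submodule.span_induction with
  | mem T hT => exact ⟨trace T, fun s c => ⟨hT.hasSum c, hT.hasSum b⟩⟩
  | zero => exact ⟨0, fun s c => by simp [hasSum_zero]⟩
  | add S T _ _ hS hT =>
    obtain ⟨z, hz⟩ := hS
    obtain ⟨w, hw⟩ := hT
    refine ⟨z + w, fun s c => ?_⟩
    simpa [inner_add_right] using
      And.intro ((hz s c).1.add (hw s c).1) ((hz s c).2.add (hw s c).2)
  | smul a T _ hT =>
    obtain ⟨z, hz⟩ := hT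
    refine ⟨a * z, fun s c => ?_⟩
    simpa [inner_smul_right] using
      And.intro ((hz s c).1.mul_left a) ((hz s c).2.mul_left a)

end QuantumDynamics

/-!
The direct part of the theorem is that conjugation by a unitary `U` is a universal dynamical map,
with inverse the conjugation by `U†`.

For the converse, let `E` and `F` be mutually inverse and completely positive. Applied entrywise,
each is then an order isomorphism on block operators, so it preserves the extremal rays of the
positive cone, which are spanned by the rank-one projections. In operator terms: if `w = B v ≠ 0`,
where `B` is the image of `|x⟩⟨x|`, then `|w⟩⟨w| ≤ ⟪v, B v⟫ B` by Cauchy–Schwarz; the image of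
`|w⟩⟨w|` under the inverse map is below a multiple of `|x⟩⟨x|`, hence is itself a multiple of
`|x⟩⟨x|`, and `B` is a multiple of `|w⟩⟨w|` (`exists_map_rankOneTC_eq`). For blocks of size one this
says that pure states go to pure states, say `|x₀⟩⟨x₀|` to `|y₀⟩⟨y₀|`. For blocks of size two, with
vectors `x₀` and `x`, it excludes antiunitary behaviour: the linear map `V x = E(|x⟩⟨x₀|) y₀`
satisfies `E(|x⟩⟨x|) = |V x⟩⟨V x|` (`exists_linearMap_map_rankOneTC`). Conservation of the trace
makes `V` isometric, and the same construction for `F` makes it surjective.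

Finally, no continuity of `E` has to be assumed. If `T` is positive with finite trace, with
square root `S`, then `T` dominates the finite sums of `|S eᵢ⟩⟨S eᵢ|`, so that `E T` dominates
their images; hence `E T - V T V†` is positive. Its trace is zero, so it vanishes
(`map_eq_conj_of_hasFiniteTrace`).
-/

namespace QuantumDynamics

open scoped InnerProductSpace ComplexOrder
open InnerProductSpace ContinuousLinearMap

/-! ### Positive operators -/

section Positive

variable {K : Type*} [NormedAddCommGroup K] [InnerProductSpace ℂ K]

theorem isPositive_iff_inner_nonneg {T : K →L[ℂ] K} :
    T.IsPositive ↔ ∀ x, 0 ≤ ⟪x, T x⟫_ℂ := by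
  refine ⟨fun h x => h.inner_nonneg_right x, fun h => ?_⟩
  rw [isPositive_iff_complex]
  intro x
  have hx := Complex.nonneg_iff.1 (h x)
  have hs : ⟪T x, x⟫_ℂ = ⟪x, T x⟫_ℂ := by
    rw [← inner_conj_symm, Complex.conj_eq_iff_im]
    exact hx.2.symm
  rw [hs]
  exact ⟨Complex.ext (by simp) (by simpa using hx.2), hx.1⟩

theorem inner_self_rankOne (w x : K) :
    ⟪x, rankOne ℂ w w x⟫_ℂ = ((‖⟪w, x⟫_ℂ‖ ^ 2 : ℝ) : ℂ) := by
  rw [rankOne_apply, inner_smul_right, ← inner_conj_symm x w, Complex.mul_conj']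
  push_cast
  rfl

variable [CompleteSpace K]

theorem exists_symmetric_sqrt {T : K →L[ℂ] K} (hT : T.IsPositive) :
    ∃ S : K →L[ℂ] K, (∀ x y, ⟪S x, y⟫_ℂ = ⟪x, S y⟫_ℂ) ∧ ∀ x, T x = S (S x) := by
  have hT0 : 0 ≤ T := (nonneg_iff_isPositive T).2 hT
  have hpos : (CFC.sqrt T).IsPositive := (nonneg_iff_isPositive _).1 (CFC.sqrt_nonneg T)
  refine ⟨CFC.sqrt T, hpos.isSymmetric, fun x => ?_⟩
  conv_lhs => rw [← CFC.sqrt_mul_sqrt_self T hT0]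
  rfl

theorem apply_eq_zero_of_inner_eq_zero {T : K →L[ℂ] K} (hT : T.IsPositive) {x : K}
    (hx : ⟪x, T x⟫_ℂ = 0) : T x = 0 := by
  obtain ⟨S, hS, hST⟩ := exists_symmetric_sqrt hT
  rw [hST, ← hS, inner_self_eq_zero] at hx
  rw [hST, hx, map_zero]

/-- The Cauchy–Schwarz inequality `|⟪T v, x⟫|² ≤ ⟪v, T v⟫ ⟪x, T x⟫` in operator form. -/
theorem isPositive_smul_sub_rankOne {T : K →L[ℂ] K} (hT : T.IsPositive) (v : K) :
    ((((⟪v, T v⟫_ℂ).re : ℝ) : ℂ) • T - rankOne ℂ (T v) (T v)).IsPositive := by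
  obtain ⟨S, hS, hST⟩ := exists_symmetric_sqrt hT
  have hn : ∀ x, ⟪x, T x⟫_ℂ = ((‖S x‖ ^ 2 : ℝ) : ℂ) := fun x => by
    rw [hST, ← hS, inner_self_eq_norm_sq_to_K]
    push_cast
    rfl
  refine isPositive_iff_inner_nonneg.2 fun x => ?_
  rw [sub_apply, inner_sub_right, inner_self_rankOne, smul_apply, inner_smul_right, hn, hn,
    Complex.ofReal_re, hST v, hS, ← Complex.ofReal_mul, ← Complex.ofReal_sub,
    Complex.zero_le_real, sub_nonneg, ← mul_pow]
  gcongr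
  exact norm_inner_le_norm _ _

/-- A rank-one positive operator spans an extremal ray of the cone of positive operators. -/
theorem exists_eq_smul_rankOne {S : K →L[ℂ] K} (hS : S.IsPositive) {x : K} {c : ℂ}
    (h : (c • rankOne ℂ x x - S).IsPositive) :
    ∃ r : ℝ, 0 ≤ r ∧ S = (r : ℂ) • rankOne ℂ x x := by
  have h0 : ∀ u, ⟪x, u⟫_ℂ = 0 → S u = 0 := fun u hu => by
    refine apply_eq_zero_of_inner_eq_zero hS (le_antisymm ?_ (hS.inner_nonneg_right u))
    have := h.inner_nonneg_right u
    simpa [hu] using this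
  rcases eq_or_ne x 0 with rfl | hx
  · exact ⟨0, le_rfl, ContinuousLinearMap.ext fun u => by simp [h0 u (by simp)]⟩
  have hxx : ⟪x, x⟫_ℂ ≠ 0 := inner_self_ne_zero.2 hx
  have hperp : ∀ z, ⟪x, z - (⟪x, z⟫_ℂ / ⟪x, x⟫_ℂ) • x⟫_ℂ = 0 := fun z => by
    rw [inner_sub_right, inner_smul_right, div_mul_cancel₀ _ hxx, sub_self]
  have hSz : ∀ z, S z = (⟪x, z⟫_ℂ / ⟪x, x⟫_ℂ) • S x := fun z => by
    have := h0 _ (hperp z)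
    rwa [map_sub, map_smul, sub_eq_zero] at this
  have hSx : S x = (⟪x, S x⟫_ℂ / ⟪x, x⟫_ℂ) • x := by
    rw [← sub_eq_zero, ← inner_self_eq_zero (𝕜 := ℂ)]
    -- By symmetry, `S x` is orthogonal to the kernel of `S`, which contains every vector
    -- orthogonal to `x`, in particular `S x - (⟪x, S x⟫ / ⟪x, x⟫) • x`.
    have hu := h0 _ (hperp (S x))
    have hux := inner_eq_zero_symm.1 (hperp (S x))
    rw [inner_sub_right, inner_smul_right, hux, ← hS.inner_left_eq_inner_right, hu]
    simp
  have hr : (((⟪x, S x⟫_ℂ).re : ℝ) : ℂ) = ⟪x, S x⟫_ℂ :=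
    Complex.ext (by simp) (by simpa using (Complex.nonneg_iff.1 (hS.inner_nonneg_right x)).2)
  refine ⟨(⟪x, S x⟫_ℂ).re / (‖x‖ ^ 2) ^ 2,
    div_nonneg (Complex.nonneg_iff.1 (hS.inner_nonneg_right x)).1 (by positivity),
    ContinuousLinearMap.ext fun z => ?_⟩
  rw [hSz, smul_apply, rankOne_apply, smul_smul]
  conv_lhs => rw [hSx, smul_smul]
  congr 1
  have hn : ((‖x‖ : ℂ)) ^ 2 = ⟪x, x⟫_ℂ := (inner_self_eq_norm_sq_to_K x).symm
  push_cast
  rw [hr, hn]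
  field_simp

end Positive

variable {H : Type*} [NormedAddCommGroup H] [InnerProductSpace ℂ H]

/-! ### Block operators -/

/-- The block operator `(T i j)` as a bounded operator on the Hilbert space direct sum of `n` copies
of `H`. -/
noncomputable def blockOp {n : ℕ} (T : Fin n → Fin n → H →L[ℂ] H) :
    PiLp 2 (fun _ : Fin n => H) →L[ℂ] PiLp 2 (fun _ : Fin n => H) :=
  ((PiLp.continuousLinearEquiv 2 ℂ (fun _ : Fin n => H)).symm :
      (Fin n → H) →L[ℂ] PiLp 2 (fun _ : Fin n => H)) ∘L
    ContinuousLinearMap.pi fun i => ∑ j, T i j ∘L PiLp.proj 2 (fun _ : Fin n => H) j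

theorem blockOp_apply {n : ℕ} (T : Fin n → Fin n → H →L[ℂ] H) (x : PiLp 2 (fun _ : Fin n => H))
    (i : Fin n) : blockOp T x i = ∑ j, T i j (x j) := by
  simp [blockOp]

theorem blockOp_isPositive_iff {n : ℕ} {T : Fin n → Fin n → H →L[ℂ] H} :
    (blockOp T).IsPositive ↔ ∀ x : Fin n → H, 0 ≤ ∑ i, ∑ j, ⟪x i, T i j (x j)⟫_ℂ := by
  simp only [isPositive_iff_inner_nonneg, PiLp.inner_apply, blockOp_apply, inner_sum]
  exact ⟨fun h x => h (WithLp.toLp 2 x), fun h x => h x⟩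

theorem blockOp_rankOne {n : ℕ} (x : PiLp 2 (fun _ : Fin n => H)) :
    blockOp (fun i j => rankOne ℂ (x i) (x j)) = rankOne ℂ x x := by
  ext z i
  simp [blockOp_apply, PiLp.inner_apply, Finset.sum_smul]

theorem blockOp_injective {n : ℕ} :
    Function.Injective (blockOp : (Fin n → Fin n → H →L[ℂ] H) → _) := by
  intro S T h
  ext i j z
  have := congrArg (fun A => A (WithLp.toLp 2 (Pi.single j z)) i) h
  simp only [blockOp_apply] at this
  rw [Finset.sum_eq_single j (by intro k _ hk; simp [hk]) (by simp),
    Finset.sum_eq_single j (by intro k _ hk; simp [hk]) (by simp)] at this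
  simpa using this

theorem blockOp_sub {n : ℕ} (S T : Fin n → Fin n → H →L[ℂ] H) :
    blockOp (fun i j => S i j - T i j) = blockOp S - blockOp T := by
  ext z i
  simp [blockOp_apply]

theorem blockOp_smul {n : ℕ} (c : ℂ) (T : Fin n → Fin n → H →L[ℂ] H) :
    blockOp (fun i j => c • T i j) = c • blockOp T := by
  ext z i
  simp [blockOp_apply, Finset.smul_sum]

/-! ### Hilbert bases and unitary conjugation -/

theorem exists_hilbertBasis_map_symm {ι : Type*} (b : HilbertBasis ι ℂ H) (e : H ≃ₗᵢ[ℂ] H) :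
    ∃ c : HilbertBasis ι ℂ H, ∀ i, c i = e.symm (b i) := by
  classical
  refine ⟨HilbertBasis.ofRepr (e.trans b.repr), fun i => ?_⟩
  rw [← HilbertBasis.repr_symm_single, ← HilbertBasis.repr_symm_single]
  rfl

theorem hasSum_trace_rankOne {ι : Type*} (b : HilbertBasis ι ℂ H) (x y : H) :
    HasSum (fun i => ⟪b i, rankOne ℂ x y (b i)⟫_ℂ) ⟪y, x⟫_ℂ := by
  simpa [rankOne_apply, inner_smul_right] using b.hasSum_inner_mul_inner y x

/-- Bessel's inequality in operator form: with `T = S²`, the vectors `S (b i)` give finite rank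
approximations of `T` from below. -/
theorem isPositive_sub_sum_rankOne {ι : Type*} (b : HilbertBasis ι ℂ H) {S T : H →L[ℂ] H}
    (hS : ∀ x y, ⟪S x, y⟫_ℂ = ⟪x, S y⟫_ℂ) (hST : ∀ x, T x = S (S x)) (s : Finset ι) :
    (T - ∑ i ∈ s, rankOne ℂ (S (b i)) (S (b i))).IsPositive := by
  refine isPositive_iff_inner_nonneg.2 fun x => ?_
  have hx : ⟪x, T x⟫_ℂ = ((‖S x‖ ^ 2 : ℝ) : ℂ) := by
    rw [hST, ← hS, inner_self_eq_norm_sq_to_K]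
    push_cast
    rfl
  rw [sub_apply, inner_sub_right, sum_apply, inner_sum, hx]
  simp only [inner_self_rankOne, hS]
  rw [← Complex.ofReal_sum, ← Complex.ofReal_sub, Complex.zero_le_real, sub_nonneg]
  exact b.orthonormal.sum_inner_products_le (S x)

/-- The conjugation `T ↦ e T e⁻¹` of bounded operators by a unitary `e`. -/
noncomputable def unitaryConj (e : H ≃ₗᵢ[ℂ] H) : (H →L[ℂ] H) →ₗ[ℂ] (H →L[ℂ] H) where
  toFun T := (e : H →L[ℂ] H) ∘L T ∘L (e.symm : H →L[ℂ] H)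
  map_add' S T := by ext; simp
  map_smul' c T := by ext; simp

theorem unitaryConj_apply (e : H ≃ₗᵢ[ℂ] H) (T : H →L[ℂ] H) (x : H) :
    unitaryConj e T x = e (T (e.symm x)) := rfl

theorem inner_unitaryConj (e : H ≃ₗᵢ[ℂ] H) (T : H →L[ℂ] H) (x y : H) :
    ⟪x, unitaryConj e T y⟫_ℂ = ⟪e.symm x, T (e.symm y)⟫_ℂ := by
  rw [unitaryConj_apply, ← e.inner_map_map (e.symm x), e.apply_symm_apply]

variable [CompleteSpace H]

/-! ### Complete positivity in terms of block operators -/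

theorem IsCompletelyPositive.blockOp_isPositive {E : traceClass H →ₗ[ℂ] traceClass H}
    (hE : IsCompletelyPositive E) {n : ℕ} {T : Fin n → Fin n → traceClass H}
    (hT : (blockOp fun i j => (T i j : H →L[ℂ] H)).IsPositive) :
    (blockOp fun i j => (E (T i j) : H →L[ℂ] H)).IsPositive :=
  blockOp_isPositive_iff.2 (hE n T (blockOp_isPositive_iff.1 hT))

theorem IsCompletelyPositive.isPositive_map {E : traceClass H →ₗ[ℂ] traceClass H}
    (hE : IsCompletelyPositive E) {T : traceClass H} (hT : (T : H →L[ℂ] H).IsPositive) :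
    (E T : H →L[ℂ] H).IsPositive := by
  refine isPositive_iff_inner_nonneg.2 fun x => ?_
  simpa using hE 1 (fun _ _ => T) (fun x => by simpa using hT.inner_nonneg_right (x 0))
    (fun _ => x)

/-! ### Rank-one operators and the trace -/

theorem trace_rankOne (x y : H) : trace (rankOne ℂ x y) = ⟪y, x⟫_ℂ :=
  (hasSum_trace_rankOne (basis H) x y).tsum_eq

theorem hasFiniteTrace_rankOne_self (x : H) : HasFiniteTrace (rankOne ℂ x x) :=
  ⟨isPositive_rankOne_self x,
    (Complex.hasSum_re (hasSum_trace_rankOne (basis H) x x)).summable⟩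

theorem rankOne_mem_traceClass (x y : H) : rankOne ℂ x y ∈ traceClass H := by
  have h : ∀ z : H, rankOne ℂ z z ∈ traceClass H := fun z =>
    Submodule.subset_span (hasFiniteTrace_rankOne_self z)
  have hpol : rankOne ℂ x y = (1 / 2 : ℂ) •
      ((rankOne ℂ (x + y) (x + y) - rankOne ℂ x x - rankOne ℂ y y) +
        Complex.I • (rankOne ℂ (x + Complex.I • y) (x + Complex.I • y) - rankOne ℂ x x -
          rankOne ℂ y y)) := by
    ext z
    simp only [rankOne_apply, smul_apply, add_apply, sub_apply, inner_add_left, inner_smul_left,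
      Complex.conj_I]
    match_scalars <;> ring_nf <;> simp [Complex.I_sq]; ring
  rw [hpol]
  exact Submodule.smul_mem _ _ (Submodule.add_mem _
    (Submodule.sub_mem _ (Submodule.sub_mem _ (h _) (h _)) (h _))
    (Submodule.smul_mem _ _ (Submodule.sub_mem _ (Submodule.sub_mem _ (h _) (h _)) (h _))))

/-- The operator `|x⟩⟨y|` as an element of the trace class. -/
noncomputable def rankOneTC (x y : H) : traceClass H := ⟨rankOne ℂ x y, rankOne_mem_traceClass x y⟩

@[simp] theorem coe_rankOneTC (x y : H) : (rankOneTC x y : H →L[ℂ] H) = rankOne ℂ x y := rfl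

theorem trace_sub {S T : H →L[ℂ] H} (hS : S ∈ traceClass H) (hT : T ∈ traceClass H) :
    trace (S - T) = trace S - trace T := by
  have h := (hasSum_trace hS (basis H)).sub (hasSum_trace hT (basis H))
  rw [← h.tsum_eq]
  simp [trace]

theorem eq_zero_of_isPositive_of_trace_eq_zero {T : H →L[ℂ] H} (hT : T.IsPositive)
    (hTC : T ∈ traceClass H) (h0 : trace T = 0) : T = 0 := by
  have h := Complex.hasSum_re (hasSum_trace hTC (basis H))
  have hnn := fun x => Complex.nonneg_iff.1 (hT.inner_nonneg_right x)
  rw [h0, Complex.zero_re, hasSum_zero_iff_of_nonneg fun i => (hnn _).1] at h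
  have hb : ∀ i, T (basis H i) = 0 := fun i =>
    apply_eq_zero_of_inner_eq_zero hT (Complex.ext (congrFun h i) (hnn _).2.symm)
  refine ContinuousLinearMap.ext_on
    (Submodule.dense_iff_topologicalClosure_eq_top.2 (basis H).dense_span) ?_
  rintro _ ⟨i, rfl⟩
  simp [hb i]

/-! ### Unitary conjugation on the trace class -/

section Conj

variable (e : H ≃ₗᵢ[ℂ] H)

theorem hasFiniteTrace_unitaryConj {T : H →L[ℂ] H} (hT : HasFiniteTrace T) :
    HasFiniteTrace (unitaryConj e T) := by
  refine ⟨isPositive_iff_inner_nonneg.2 fun x => ?_, ?_⟩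
  · rw [inner_unitaryConj]
    exact hT.1.inner_nonneg_right _
  · obtain ⟨c, hc⟩ := exists_hilbertBasis_map_symm (basis H) e
    simp only [inner_unitaryConj, ← hc]
    exact (Complex.hasSum_re (hT.hasSum c)).summable

theorem unitaryConj_mem_traceClass {T : H →L[ℂ] H} (hT : T ∈ traceClass H) :
    unitaryConj e T ∈ traceClass H := by
  have h : traceClass H ≤ (traceClass H).comap (unitaryConj e) :=
    Submodule.span_le.2 fun T hT => Submodule.subset_span (hasFiniteTrace_unitaryConj e hT)
  exact h hT

theorem trace_unitaryConj {T : H →L[ℂ] H} (hT : T ∈ traceClass H) :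
    trace (unitaryConj e T) = trace T := by
  obtain ⟨c, hc⟩ := exists_hilbertBasis_map_symm (basis H) e
  rw [← (hasSum_trace hT c).tsum_eq]
  simp only [trace, inner_unitaryConj, hc]

theorem isUniversalDynamicalMap_of_unitaryConj {E : traceClass H →ₗ[ℂ] traceClass H}
    (hE : ∀ T : traceClass H, (E T : H →L[ℂ] H) = unitaryConj e T) :
    IsUniversalDynamicalMap E where
  completelyPositive n T hT x := by
    simp only [hE, inner_unitaryConj]
    exact hT fun i => e.symm (x i)
  tracePreserving T := by rw [hE, trace_unitaryConj e T.2]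

theorem coe_comp_comp_adjoint (T : H →L[ℂ] H) :
    (e : H →L[ℂ] H) ∘L T ∘L adjoint (e : H →L[ℂ] H) = unitaryConj e T := by
  rw [LinearIsometryEquiv.adjoint_eq_symm]
  rfl

theorem isUnitaryConjugation_iff {E : traceClass H →ₗ[ℂ] traceClass H} :
    IsUnitaryConjugation E ↔
      ∃ e : H ≃ₗᵢ[ℂ] H, ∀ T : traceClass H, (E T : H →L[ℂ] H) = unitaryConj e T := by
  constructor
  · rintro ⟨U, hU, h⟩
    refine ⟨Unitary.linearIsometryEquiv ⟨U, hU⟩, fun T => ?_⟩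
    rw [h, ← coe_comp_comp_adjoint]
    rfl
  · rintro ⟨e, h⟩
    refine ⟨_, (Unitary.linearIsometryEquiv.symm e).2, fun T => ?_⟩
    rw [h, ← coe_comp_comp_adjoint]
    rfl

end Conj

/-! ### Images of rank-one operators -/

/-- The entrywise action of an invertible completely positive map preserves the rank-one positive
block operators. -/
theorem exists_map_rankOneTC_eq {E F : traceClass H →ₗ[ℂ] traceClass H}
    (hE : IsCompletelyPositive E) (hF : IsCompletelyPositive F) (hFE : ∀ T, F (E T) = T)
    (hEF : ∀ T, E (F T) = T) {n : ℕ} (x : Fin n → H) :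
    ∃ y : Fin n → H, ∀ i j, E (rankOneTC (x i) (x j)) = rankOneTC (y i) (y j) := by
  have hpos : ∀ z : PiLp 2 (fun _ : Fin n => H),
      (blockOp fun i j => (rankOneTC (z i) (z j) : H →L[ℂ] H)).IsPositive := fun z => by
    simp only [coe_rankOneTC, blockOp_rankOne]
    exact isPositive_rankOne_self z
  obtain ⟨B, hB⟩ : ∃ B, B = blockOp fun i j => (E (rankOneTC (x i) (x j)) : H →L[ℂ] H) := ⟨_, rfl⟩
  have hBpos : B.IsPositive := hB ▸ hE.blockOp_isPositive (hpos (WithLp.toLp 2 x))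
  by_cases hB0 : B = 0
  · refine ⟨0, fun i j => Subtype.ext ?_⟩
    have h0 : blockOp (fun i j => (E (rankOneTC (x i) (x j)) : H →L[ℂ] H)) =
        blockOp (fun _ _ => 0) := by
      rw [← hB, hB0]
      ext z i
      simp [blockOp_apply]
    simpa using congrFun₂ (blockOp_injective h0) i j
  obtain ⟨v, hv⟩ : ∃ v, B v ≠ 0 := by
    by_contra! h
    exact hB0 (ContinuousLinearMap.ext h)
  obtain ⟨w, hw⟩ : ∃ w, w = B v := ⟨_, rfl⟩
  obtain ⟨c, hc⟩ : ∃ c : ℂ, c = (((⟪v, B v⟫_ℂ).re : ℝ) : ℂ) := ⟨_, rfl⟩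
  -- `|w⟩⟨w| ≤ c B`; applying `F` gives `F(|w⟩⟨w|) ≤ c |x⟩⟨x|`, and extremality applies.
  have h1 := isPositive_smul_sub_rankOne hBpos v
  rw [← hc, ← hw] at h1
  have h2 : (blockOp fun i j => ((c • E (rankOneTC (x i) (x j)) - rankOneTC (w i) (w j) :
      traceClass H) : H →L[ℂ] H)).IsPositive := by
    simpa only [Submodule.coe_sub, Submodule.coe_smul, blockOp_sub, blockOp_smul, ← hB,
      coe_rankOneTC, blockOp_rankOne] using h1
  have h3 := hF.blockOp_isPositive h2
  simp only [map_sub, map_smul, hFE, Submodule.coe_sub, Submodule.coe_smul, blockOp_sub,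
    blockOp_smul] at h3
  have hx : blockOp (fun i j => (rankOneTC (x i) (x j) : H →L[ℂ] H)) =
      rankOne ℂ (WithLp.toLp 2 x) (WithLp.toLp 2 x) := blockOp_rankOne (WithLp.toLp 2 x)
  rw [hx] at h3
  obtain ⟨r, hr, h4⟩ := exists_eq_smul_rankOne (hF.blockOp_isPositive (hpos w)) h3
  rw [← hx, ← blockOp_smul] at h4
  have h5 : ∀ i j, rankOneTC (w i) (w j) = (r : ℂ) • E (rankOneTC (x i) (x j)) := fun i j => by
    rw [← map_smul, ← hEF (rankOneTC (w i) (w j))]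
    exact congrArg E (Subtype.ext (congrFun₂ (blockOp_injective h4) i j))
  have hr0 : r ≠ 0 := by
    rintro rfl
    refine hv (hw ▸ PiLp.ext fun i => ?_)
    simpa using congrArg Subtype.val (h5 i i)
  have hsq : ((Real.sqrt r : ℝ) : ℂ) * ((Real.sqrt r : ℝ) : ℂ) = r := by
    rw [← Complex.ofReal_mul, Real.mul_self_sqrt hr]
  have hrC : (r : ℂ) ≠ 0 := by exact_mod_cast hr0
  refine ⟨fun i => ((Real.sqrt r : ℝ) : ℂ)⁻¹ • w i, fun i j => ?_⟩
  have h6 : E (rankOneTC (x i) (x j)) = (r : ℂ)⁻¹ • rankOneTC (w i) (w j) := by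
    rw [h5, smul_smul, inv_mul_cancel₀ hrC, one_smul]
  rw [h6]
  ext z
  simp only [Submodule.coe_smul, smul_apply, coe_rankOneTC, rankOne_apply, inner_smul_left,
    map_inv₀, Complex.conj_ofReal, smul_smul]
  congr 1
  rw [← hsq, mul_inv]
  ring

/-- The vectors given by `exists_map_rankOneTC_eq` for the pair `(x₀, x)` are determined only up to
a common phase; applying `E(|x⟩⟨x₀|)` to the fixed vector `y₀` chooses the phase linearly in `x`. -/
theorem exists_linearMap_map_rankOneTC {E F : traceClass H →ₗ[ℂ] traceClass H}
    (hE : IsCompletelyPositive E) (hF : IsCompletelyPositive F) (hFE : ∀ T, F (E T) = T)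
    (hEF : ∀ T, E (F T) = T) {x₀ y₀ : H} (hy₀ : ‖y₀‖ = 1)
    (h₀ : E (rankOneTC x₀ x₀) = rankOneTC y₀ y₀) :
    ∃ V : H →ₗ[ℂ] H, ∀ x, E (rankOneTC x x₀) = rankOneTC (V x) y₀ ∧
      E (rankOneTC x x) = rankOneTC (V x) (V x) := by
  have hadd : ∀ x y, rankOneTC (x + y) x₀ = rankOneTC x x₀ + rankOneTC y x₀ := fun x y => by
    ext z; simp
  have hsmul : ∀ (c : ℂ) x, rankOneTC (c • x) x₀ = c • rankOneTC x x₀ := fun c x => by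
    ext z
    simp only [coe_rankOneTC, Submodule.coe_smul, smul_apply, rankOne_apply]
    exact smul_comm _ _ _
  refine ⟨{ toFun := fun x => (E (rankOneTC x x₀) : H →L[ℂ] H) y₀
            map_add' := fun x y => by simp [hadd]
            map_smul' := fun c x => by simp [hsmul] }, fun x => ?_⟩
  obtain ⟨y, hy⟩ := exists_map_rankOneTC_eq hE hF hFE hEF ![x₀, x]
  have h00 : rankOneTC y₀ y₀ = rankOneTC (y 0) (y 0) := h₀.symm.trans (hy 0 0)
  have h10 : E (rankOneTC x x₀) = rankOneTC (y 1) (y 0) := hy 1 0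
  have h11 : E (rankOneTC x x) = rankOneTC (y 1) (y 1) := hy 1 1
  have hyy : ⟪y₀, y₀⟫_ℂ = 1 := by simp [inner_self_eq_norm_sq_to_K, hy₀]
  have happ : ∀ z, ⟪y₀, z⟫_ℂ • y₀ = ⟪y 0, z⟫_ℂ • y 0 := fun z =>
    congrArg (fun T : traceClass H => (T : H →L[ℂ] H) z) h00
  -- Both identities reduce to `|⟪y 0, y₀⟫| = 1` and `⟪y 0, y₀⟫ ⟪y₀, z⟫ = ⟪y 0, z⟫`.
  have hphase : ⟪y 0, y₀⟫_ℂ * ⟪y₀, y 0⟫_ℂ = 1 := by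
    have := congrArg (fun u => ⟪y₀, u⟫_ℂ) (happ y₀)
    simpa only [inner_smul_right, hyy, mul_one] using this.symm
  have hz : ∀ z, ⟪y₀, z⟫_ℂ * ⟪y 0, y₀⟫_ℂ = ⟪y 0, z⟫_ℂ := fun z => by
    have := congrArg (fun u => ⟪y₀, u⟫_ℂ) (happ z)
    simp only [inner_smul_right, hyy, mul_one] at this
    rw [this, mul_assoc, mul_comm ⟪y₀, y 0⟫_ℂ, hphase, mul_one]
  constructor
  · ext z
    simp only [h10, LinearMap.coe_mk, AddHom.coe_mk, coe_rankOneTC, rankOne_apply, smul_smul, hz]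
  · rw [h11]
    ext z
    simp only [h10, LinearMap.coe_mk, AddHom.coe_mk, coe_rankOneTC, rankOne_apply, smul_smul,
      inner_smul_left, inner_conj_symm]
    congr 1
    rw [mul_assoc, mul_comm, mul_assoc, mul_comm _ ⟪y₀, y 0⟫_ℂ]
    rw [mul_comm] at hphase
    linear_combination (-⟪y 1, z⟫_ℂ) * hphase

/-- Invertible universal dynamical maps act on rank-one positive operators as unitary
conjugations. -/
theorem exists_linearIsometryEquiv_map_rankOneTC {E F : traceClass H →ₗ[ℂ] traceClass H}
    (hE : IsUniversalDynamicalMap E) (hF : IsUniversalDynamicalMap F) (hFE : ∀ T, F (E T) = T)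
    (hEF : ∀ T, E (F T) = T) :
    ∃ e : H ≃ₗᵢ[ℂ] H, ∀ x, E (rankOneTC x x) = rankOneTC (e x) (e x) := by
  have hnorm : ∀ {x y : H}, E (rankOneTC x x) = rankOneTC y y → ‖y‖ = ‖x‖ := fun {x y} h => by
    have ht := hE.tracePreserving (rankOneTC x x)
    rw [h, coe_rankOneTC, coe_rankOneTC, trace_rankOne, trace_rankOne,
      inner_self_eq_norm_sq_to_K, inner_self_eq_norm_sq_to_K] at ht
    have ht' : ‖y‖ ^ 2 = ‖x‖ ^ 2 := by exact_mod_cast ht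
    exact (sq_eq_sq₀ (norm_nonneg _) (norm_nonneg _)).1 ht'
  -- On the zero space there is no unit vector to start from.
  rcases subsingleton_or_nontrivial H with hs | hn
  · exact ⟨LinearIsometryEquiv.refl ℂ H, fun x =>
      Subtype.ext (ContinuousLinearMap.ext fun z => Subsingleton.elim _ _)⟩
  obtain ⟨x₀, hx₀⟩ := exists_norm_eq H zero_le_one
  obtain ⟨y, hy⟩ := exists_map_rankOneTC_eq hE.completelyPositive hF.completelyPositive hFE hEF
    (fun _ : Fin 1 => x₀)
  obtain ⟨y₀, h₀⟩ : ∃ y₀, E (rankOneTC x₀ x₀) = rankOneTC y₀ y₀ := ⟨y 0, hy 0 0⟩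
  have hy₀ : ‖y₀‖ = 1 := (hnorm h₀).trans hx₀
  obtain ⟨V, hV⟩ := exists_linearMap_map_rankOneTC hE.completelyPositive hF.completelyPositive
    hFE hEF hy₀ h₀
  obtain ⟨W, hW⟩ := exists_linearMap_map_rankOneTC hF.completelyPositive hE.completelyPositive
    hEF hFE hx₀ (by rw [← h₀, hFE])
  have hVW : ∀ z, V (W z) = z := fun z => by
    have h : rankOneTC (V (W z)) y₀ = rankOneTC z y₀ := by
      rw [← (hV (W z)).1, ← (hW z).1, hEF]
    have := congrArg (fun T : traceClass H => (T : H →L[ℂ] H) y₀) h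
    simpa [inner_self_eq_norm_sq_to_K, hy₀] using this
  let V' : H →ₗᵢ[ℂ] H := ⟨V, fun x => hnorm (hV x).2⟩
  exact ⟨LinearIsometryEquiv.ofSurjective V' fun z => ⟨W z, hVW z⟩, fun x => (hV x).2⟩

/-! ### Extension to the trace class -/

/-- `E T` dominates `e T e⁻¹`, by finite rank approximation from below, and the two have the same
trace. -/
theorem map_eq_conj_of_hasFiniteTrace {E : traceClass H →ₗ[ℂ] traceClass H}
    (hE : IsUniversalDynamicalMap E) (e : H ≃ₗᵢ[ℂ] H)
    (he : ∀ x, E (rankOneTC x x) = rankOneTC (e x) (e x)) (T : traceClass H)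
    (hT : HasFiniteTrace (T : H →L[ℂ] H)) : (E T : H →L[ℂ] H) = unitaryConj e T := by
  obtain ⟨S, hS, hST⟩ := exists_symmetric_sqrt hT.1
  rw [← sub_eq_zero]
  have hmem := unitaryConj_mem_traceClass e T.2
  refine eq_zero_of_isPositive_of_trace_eq_zero ?_ (Submodule.sub_mem _ (E T).2 hmem) ?_
  · have hpos := hE.completelyPositive.isPositive_map (T := T) hT.1
    -- Taking the supremum over `s` turns the left side into `⟪x, (e T e⁻¹) x⟫`.
    have hle : ∀ (s : Finset (basisIndex H)) (x : H),
        ∑ i ∈ s, ‖⟪basis H i, S (e.symm x)⟫_ℂ‖ ^ 2 ≤ (⟪x, (E T : H →L[ℂ] H) x⟫_ℂ).re := by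
      intro s x
      have h := hE.completelyPositive.isPositive_map
        (T := T - ∑ i ∈ s, rankOneTC (S (basis H i)) (S (basis H i)))
        (by simpa using isPositive_sub_sum_rankOne (basis H) hS hST s)
      have hx := (Complex.nonneg_iff.1 (h.inner_nonneg_right x)).1
      simp only [map_sub, map_sum, he, Submodule.coe_sub, Submodule.coe_sum, sub_apply, sum_apply,
        inner_sub_right, inner_sum, coe_rankOneTC, inner_self_rankOne, ← Complex.ofReal_sum,
        Complex.sub_re, Complex.ofReal_re, sub_nonneg] at hx
      refine le_trans (le_of_eq (Finset.sum_congr rfl fun i _ => ?_)) hx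
      rw [← hS, ← e.inner_map_map (S (basis H i)), e.apply_symm_apply]
    refine isPositive_iff_inner_nonneg.2 fun x => ?_
    have hsum : HasSum (fun i => ‖⟪basis H i, S (e.symm x)⟫_ℂ‖ ^ 2) (‖S (e.symm x)‖ ^ 2) := by
      have h := Complex.hasSum_re
        ((basis H).hasSum_inner_mul_inner (S (e.symm x)) (S (e.symm x)))
      rw [inner_self_eq_norm_sq_to_K] at h
      convert h using 2 with i
      · rw [← inner_conj_symm (S (e.symm x)), Complex.conj_mul']
        norm_cast
      · norm_cast
    have hx := hasSum_le_of_sum_le hsum fun s => hle s x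
    have hEx := Complex.nonneg_iff.1 (hpos.inner_nonneg_right x)
    have hTx : ⟪x, unitaryConj e T x⟫_ℂ = ((‖S (e.symm x)‖ ^ 2 : ℝ) : ℂ) := by
      rw [inner_unitaryConj, hST, ← hS, inner_self_eq_norm_sq_to_K]
      push_cast
      rfl
    rw [sub_apply, inner_sub_right, hTx, Complex.nonneg_iff]
    refine ⟨?_, ?_⟩
    · rw [Complex.sub_re, Complex.ofReal_re]
      exact sub_nonneg.2 hx
    · rw [Complex.sub_im, Complex.ofReal_im, sub_zero]
      exact hEx.2
  · rw [trace_sub (E T).2 hmem, hE.tracePreserving, trace_unitaryConj e T.2, sub_self]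

theorem map_eq_conj {E : traceClass H →ₗ[ℂ] traceClass H}
    (hE : IsUniversalDynamicalMap E) (e : H ≃ₗᵢ[ℂ] H)
    (he : ∀ x, E (rankOneTC x x) = rankOneTC (e x) (e x)) (T : traceClass H) :
    (E T : H →L[ℂ] H) = unitaryConj e T := by
  obtain ⟨T, hT⟩ := T
  induction hT using Submodule.span_induction with
  | mem T hT => exact map_eq_conj_of_hasFiniteTrace hE e he ⟨T, _⟩ hT
  | zero =>
    change (E 0 : H →L[ℂ] H) = unitaryConj e 0
    simp
  | add S T hS hT ihS ihT =>
    change (E (⟨S, hS⟩ + ⟨T, hT⟩) : H →L[ℂ] H) = unitaryConj e (S + T)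
    rw [map_add, map_add, Submodule.coe_add, ihS, ihT]
  | smul a T hT ih =>
    change (E (a • ⟨T, hT⟩) : H →L[ℂ] H) = unitaryConj e (a • T)
    rw [map_smul, map_smul, Submodule.coe_smul, ih]

end QuantumDynamics

open QuantumDynamics in
theorem theorem4p5 {H : Type*} [NormedAddCommGroup H] [InnerProductSpace ℂ H] [CompleteSpace H]
    (E : traceClass H →ₗ[ℂ] traceClass H) (hE : IsUniversalDynamicalMap E) :
    (∃ F : traceClass H →ₗ[ℂ] traceClass H,
        IsUniversalDynamicalMap F ∧ F ∘ₗ E = LinearMap.id ∧ E ∘ₗ F = LinearMap.id) ↔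
      IsUnitaryConjugation E := by
  rw [isUnitaryConjugation_iff]
  constructor
  · rintro ⟨F, hF, hFE, hEF⟩
    obtain ⟨e, he⟩ := exists_linearIsometryEquiv_map_rankOneTC hE hF (LinearMap.congr_fun hFE)
      (LinearMap.congr_fun hEF)
    exact ⟨e, map_eq_conj hE e he⟩
  · rintro ⟨e, he⟩
    refine ⟨(unitaryConj e.symm).restrict fun T hT => unitaryConj_mem_traceClass e.symm hT,
      isUniversalDynamicalMap_of_unitaryConj e.symm fun T => rfl, ?_, ?_⟩
    · ext T x
      simp [he, unitaryConj_apply]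
    · ext T x
      simp [he, unitaryConj_apply]
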